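/- For $\lambda>0$ and probability measures $\mu,\nu$ on $\mathbb{R}^d$ with the Euclidean distance, let $$W^{(\lambda)}(\mu,\nu)=\inf_{\pi\in\Pi(\mu,\nu)}\int \min\{\|x-y\|,2\lambda\}\,d\pi(x,y),$$ where $\Pi(\mu,\nu)$ is the set of measures on $\mathbb{R}^d\times\mathbb{R}^d$ with marginals $\mu$ and $\nu$. Write $a\wedge b=\min\{a,b\}$. **Theorem.** There is an absolute constant $C>0$ such that the following holds for all integers $d\ge 0$, $n\ge 1$ and all reals $K>0$, $\lambda>0$. Let $\mu$ be a probability measure on $\mathbb{R}^d$ supported in the Euclidean ball $B(0,K)$, let $X_1,\dots,X_n$ be i.i.d. with law $\mu$, and let $\hat\mu_n=\frac1n\sum_{i=1}^n\delta_{X_i}$. Then $W^{(\lambda)}(\mu,\hat\mu_n)$ is an integrable random variable, and: * if $d=1$, then $\mathrm{E}\,W^{(\lambda)}(\mu,\hat\mu_n)\le C\sqrt{\dfrac{K(K\wedge\lambda)}{n}}$; * if $d=2$, then $\mathrm{E}\,W^{(\lambda)}(\mu,\hat\mu_n)\le \dfrac{CK}{\sqrt n}\Big(1+\max\Big\{0,\log\dfrac{\sqrt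 n\,(K\wedge\lambda)}{K}\Big\}\Big)$, and, whenever $n$ is large enough that $2K\le\sqrt n$ and $K(K\wedge\lambda)\le\sqrt n$, $\ \mathrm{E}\,W^{(\lambda)}(\mu,\hat\mu_n)\le \dfrac{CK}{\sqrt n}\log\Big(\dfrac{\sqrt n}{K}\Big)$; * if $d\ge 3$, then $\mathrm{E}\,W^{(\lambda)}(\mu,\hat\mu_n)\le \dfrac{CK}{n^{1/d}}$. -/

import Mathlib

open MeasureTheory ProbabilityTheory

noncomputable section

/-- The transport plans between `μ` and `ν`: the measures on the product with first marginal `μ`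
and second marginal `ν`. If `μ` is a probability measure, then so is every member. -/
def transportPlans {X : Type*} [MeasurableSpace X] (μ ν : Measure X) : Set (Measure (X × X)) :=
  {π | π.map Prod.fst = μ ∧ π.map Prod.snd = ν}

/-- The trimmed cost `c_λ(x, y) = min {d(x, y), 2 λ}`. -/
def trimmedCost {X : Type*} [PseudoMetricSpace X] (lam : ℝ) (x y : X) : ℝ :=
  min (dist x y) (2 * lam)

/-- The robust Wasserstein distance `W^{(λ)}(μ, ν)`: the infimum of `∫ c_λ dπ` over all transport
plans. For probability measures on a separable metric space and `λ > 0` the infimum is over a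
nonempty set of nonnegative numbers (the product measure is a plan), and each integrand is
bounded and measurable. -/
def robustWasserstein {X : Type*} [PseudoMetricSpace X] [MeasurableSpace X]
    (lam : ℝ) (μ ν : Measure X) : ℝ :=
  sInf ((fun π : Measure (X × X) => ∫ z, trimmedCost lam z.1 z.2 ∂π) '' transportPlans μ ν)

/-- The empirical measure `n⁻¹ ∑ δ_{x_i}` of the points `x_1, …, x_n`. -/
def empiricalMeasure {X : Type*} [MeasurableSpace X] {n : ℕ} (x : Fin n → X) : Measure X :=
  (n : ENNReal)⁻¹ • ∑ i, Measure.dirac (x i)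

end

/-! The proof is dyadic chaining. Nets of `B(0,K)` at the scales `r_j = R / 2^j`, with at most
`(3K/r_j)^d` points, form a tree: the parent of a net point is a net point of the next coarser scale
within `r_j` of it. To transport one weight to another on the leaves, leave the common part in
place, send the excess and the deficit to their parents, and repeat; at the root use the product
plan. A move over distance `r_j` at both ends costs `2 r_j` per unit of mass, and the mass moved is
half the `ℓ¹` distance of the weights, so level `j+1` contributes `r_j` times that distance
(`hasFinitePlan_treeBound`). The truncation `2λ` matters only at the root: costs there are at most
`2 min(K, λ)`, so the tree may start at `R = min K λ` instead of `K`.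

For `μ` and its empirical measure, the `ℓ¹` distance over `N` cells has expectation at most
`√(N/n)`, by the binomial variance and Cauchy–Schwarz (`integral_sum_abs_cellDiff_le`). Hence the
expected distance is at most a multiple of `r_m + ∑_{j ≤ m} r_j √((3K/r_j)^d / n)` for every `m`
(`integral_robustWasserstein_le_sum`). The terms decay geometrically for `d = 1`, are all equal for
`d = 2`, which produces the logarithm, and grow geometrically for `d ≥ 3`, so there the finest
scale, about `K / n^(1/d)`, dominates. -/

/-! ### Covers of Euclidean balls -/

/-- An `r`-separated subset of the ball of radius `K` has at most `(3K/r)^d` points. -/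
theorem card_le_of_pairwise_separated {d : ℕ} {K r : ℝ} (hr : 0 < r) (hrK : r ≤ K)
    (s : Finset (EuclideanSpace ℝ (Fin d))) (hs : ∀ c ∈ s, ‖c‖ ≤ K)
    (h : ∀ c ∈ s, ∀ e ∈ s, c ≠ e → r ≤ ‖c - e‖) : (s.card : ℝ) ≤ (3 * K / r) ^ d := by
  set μ : Measure (EuclideanSpace ℝ (Fin d)) := volume
  set δ : ℝ := r / 2 with hδ
  -- Balls of radius `r/2` about the points are disjoint and, as `r ≤ K`, lie in the ball of radius
  -- `K + r/2 ≤ 3K/2`; compare volumes.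
  set ρ : ℝ := 3 * K / 2 with hρ
  have δpos : 0 < δ := by positivity
  have ρpos : 0 < ρ := by have := hr.trans_le hrK; positivity
  have hdisj : Set.Pairwise (s : Set (EuclideanSpace ℝ (Fin d)))
      (Function.onFun Disjoint fun c => Metric.ball c δ) := by
    rintro c hc e he hce
    apply Metric.ball_disjoint_ball
    rw [dist_eq_norm, hδ, add_halves]
    exact h c hc e he hce
  have hsub : (⋃ c ∈ s, Metric.ball c δ) ⊆ Metric.ball 0 ρ := by
    refine Set.iUnion₂_subset fun x hx => Metric.ball_subset_ball' ?_
    have := hs x hx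
    rw [dist_zero_right, hδ, hρ]
    linarith
  have hvol : (s.card : ENNReal) * ENNReal.ofReal (δ ^ d) * μ (Metric.ball 0 1) ≤
      ENNReal.ofReal (ρ ^ d) * μ (Metric.ball 0 1) :=
    calc
      _ = μ (⋃ c ∈ s, Metric.ball c δ) := by
        rw [measure_biUnion_finset hdisj fun c _ => measurableSet_ball]
        simp only [μ.addHaar_ball_of_pos _ δpos, finrank_euclideanSpace_fin]
        simp only [Finset.sum_const, nsmul_eq_mul, mul_assoc]
      _ ≤ μ (Metric.ball 0 ρ) := measure_mono hsub
      _ = _ := by simp only [μ.addHaar_ball_of_pos _ ρpos, finrank_euclideanSpace_fin]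
  have hcard : (s.card : ENNReal) * ENNReal.ofReal (δ ^ d) ≤ ENNReal.ofReal (ρ ^ d) :=
    (ENNReal.mul_le_mul_iff_left (Metric.measure_ball_pos _ _ zero_lt_one).ne'
      measure_ball_lt_top.ne).1 hvol
  have hreal : (s.card : ℝ) * δ ^ d ≤ ρ ^ d := by
    have := ENNReal.toReal_le_of_le_ofReal (pow_nonneg ρpos.le _) hcard
    simpa [ENNReal.toReal_ofReal (pow_nonneg δpos.le d)] using this
  have : 3 * K / r = ρ / δ := by rw [hρ, hδ]; field_simp
  rw [this, div_pow, le_div_iff₀ (by positivity)]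
  exact hreal

/-- A ball of radius `K` has an `r`-net of at most `(3K/r)^d` points. -/
theorem exists_finset_net_closedBall (d : ℕ) {K r : ℝ} (hr : 0 < r) (hrK : r ≤ K) :
    ∃ s : Finset (EuclideanSpace ℝ (Fin d)), (s.card : ℝ) ≤ (3 * K / r) ^ d ∧
      (∀ c ∈ s, ‖c‖ ≤ K) ∧ ∀ x : EuclideanSpace ℝ (Fin d), ‖x‖ ≤ K → ∃ c ∈ s, dist x c ≤ r := by
  classical
  let good : Finset (EuclideanSpace ℝ (Fin d)) → Prop := fun s =>
    (∀ c ∈ s, ‖c‖ ≤ K) ∧ ∀ c ∈ s, ∀ e ∈ s, c ≠ e → r ≤ ‖c - e‖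
  let Q : ℕ → Prop := fun k => ∃ s, good s ∧ s.card = k
  have hQ0 : Q 0 := ⟨∅, by simp [good], rfl⟩
  have hbound : ∀ k, Q k → k ≤ ⌊(3 * K / r) ^ d⌋₊ := by
    rintro k ⟨s, hs, rfl⟩
    exact Nat.le_floor (card_le_of_pairwise_separated hr hrK s hs.1 hs.2)
  -- A separated set of greatest cardinality is a net, since an uncovered point could be added to
  -- it.
  obtain ⟨s, hs, hcard⟩ := Nat.findGreatest_spec (P := Q) (Nat.zero_le ⌊(3 * K / r) ^ d⌋₊) hQ0
  refine ⟨s, card_le_of_pairwise_separated hr hrK s hs.1 hs.2, hs.1, fun x hx => ?_⟩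
  by_contra! hfar
  have hxs : x ∉ s := fun hxs => by
    have := hfar x hxs
    rw [dist_self] at this
    linarith
  have hins : good (insert x s) := by
    refine ⟨?_, ?_⟩
    · simpa [hx] using hs.1
    · intro c hc e he hce
      rcases Finset.mem_insert.1 hc with rfl | hc' <;> rcases Finset.mem_insert.1 he with rfl | he'
      · exact absurd rfl hce
      · rw [← dist_eq_norm]; exact (hfar e he').le
      · rw [← dist_eq_norm, dist_comm]; exact (hfar c hc').le
      · exact hs.2 c hc' e he' hce
  have hQ : Q (s.card + 1) := ⟨_, hins, Finset.card_insert_of_notMem hxs⟩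
  have := Nat.le_findGreatest (hbound _ hQ) hQ
  omega

/-- A ball of radius `K` has a measurable nearest-point quantizer onto at most `(3K/r)^d` points. -/
theorem exists_quantizer (d : ℕ) {K r : ℝ} (hr : 0 < r) (hrK : r ≤ K) :
    ∃ (N : ℕ) (pos : Fin N → EuclideanSpace ℝ (Fin d)) (s : EuclideanSpace ℝ (Fin d) → Fin N),
      (N : ℝ) ≤ (3 * K / r) ^ d ∧ (∀ i, ‖pos i‖ ≤ K) ∧ Measurable s ∧
      ∀ x, ‖x‖ ≤ K → dist x (pos (s x)) ≤ r := by
  obtain ⟨S, hcard, hS, hcov⟩ := exists_finset_net_closedBall d hr hrK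
  have hpos : 0 < S.card := by
    obtain ⟨c, hc, -⟩ := hcov 0 (by simpa using (hr.trans_le hrK).le)
    exact Finset.card_pos.2 ⟨c, hc⟩
  let pos : Fin S.card → EuclideanSpace ℝ (Fin d) := fun i => S.equivFin.symm i
  -- The default only makes the map total: `nearestPtInd e (S.card - 1)` never exceeds `S.card - 1`.
  let toFin : ℕ → Fin S.card := fun k => if h : k < S.card then ⟨k, h⟩ else ⟨0, hpos⟩
  let e : ℕ → EuclideanSpace ℝ (Fin d) := fun k => pos (toFin k)
  refine ⟨S.card, pos, fun x => toFin (SimpleFunc.nearestPtInd e (S.card - 1) x), hcard,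
    fun i => hS _ (S.equivFin.symm i).2,
    (measurable_of_countable toFin).comp (SimpleFunc.measurable _), fun x hx => ?_⟩
  obtain ⟨c, hc, hxc⟩ := hcov x hx
  let i := S.equivFin ⟨c, hc⟩
  have hi : e i = c := by simp [e, toFin, pos, i]
  have h := SimpleFunc.edist_nearestPt_le e x (Nat.le_sub_one_of_lt i.2)
  rw [hi, edist_dist, edist_dist, ENNReal.ofReal_le_ofReal_iff dist_nonneg] at h
  rw [dist_comm]
  refine h.trans ?_
  rwa [dist_comm]

/-! ### Transport plans between weights on finite sets -/

/-- There is a transport plan of cost at most `B` between the weights `a` and `b`. -/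
def HasFinitePlan {ι : Type*} [Fintype ι] (c : ι → ι → ℝ) (a b : ι → ℝ) (B : ℝ) : Prop :=
  ∃ π : ι → ι → ℝ, (∀ i j, 0 ≤ π i j) ∧ (∀ i, ∑ j, π i j = a i) ∧ (∀ j, ∑ i, π i j = b j) ∧
    ∑ i, ∑ j, π i j * c i j ≤ B

/-- The image of a weight under a map. -/
def pushWeight {ι κ : Type*} [Fintype ι] [DecidableEq κ] (f : ι → κ) (a : ι → ℝ) (k : κ) : ℝ :=
  ∑ i with f i = k, a i

section FinitePlan

variable {ι κ : Type*} [Fintype ι] [DecidableEq κ]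

theorem sum_pushWeight [Fintype κ] (f : ι → κ) (a : ι → ℝ) : ∑ k, pushWeight f a k = ∑ i, a i :=
  Finset.sum_fiberwise _ f a

theorem pushWeight_sub (f : ι → κ) (a b : ι → ℝ) :
    pushWeight f (a - b) = pushWeight f a - pushWeight f b := by
  ext k; simp [pushWeight]

theorem pushWeight_nonneg (f : ι → κ) {a : ι → ℝ} (ha : ∀ i, 0 ≤ a i) (k : κ) :
    0 ≤ pushWeight f a k := Finset.sum_nonneg fun i _ => ha i

theorem le_pushWeight (f : ι → κ) {a : ι → ℝ} (ha : ∀ i, 0 ≤ a i) (i : ι) :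
    a i ≤ pushWeight f a (f i) :=
  Finset.single_le_sum (f := a) (fun i _ => ha i) (by simp)

/-- Splitting a weight `w` on `κ`, dominated by the image of `a`, along the fibres of `f`. -/
theorem sum_split_fibres [Fintype κ] (f : ι → κ) {a : ι → ℝ} {w : κ → ℝ} (hw : ∀ k, pushWeight f a k = 0 → w k = 0) :
    ∑ i, a i / pushWeight f a (f i) * w (f i) = ∑ k, w k := by
  rw [← Finset.sum_fiberwise Finset.univ f]
  refine Finset.sum_congr rfl fun k _ => ?_
  have : ∀ i ∈ Finset.univ.filter (fun i => f i = k),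
      a i / pushWeight f a (f i) * w (f i) = a i * (w k / pushWeight f a k) := by
    intro i hi
    rw [(Finset.mem_filter.1 hi).2]; ring
  rw [Finset.sum_congr rfl this, ← Finset.sum_mul]
  change pushWeight f a k * _ = _
  by_cases h : pushWeight f a k = 0
  · rw [h, hw k h]; simp
  · field_simp

theorem HasFinitePlan.mono {c : ι → ι → ℝ} {a b : ι → ℝ} {B B' : ℝ} (h : HasFinitePlan c a b B)
    (hB : B ≤ B') : HasFinitePlan c a b B' := by
  obtain ⟨π, h0, h1, h2, h3⟩ := h
  exact ⟨π, h0, h1, h2, h3.trans hB⟩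

/-- A plan between the images under `f` lifts to a plan between the weights. -/
theorem HasFinitePlan.lift [Fintype κ] {f : ι → κ} {c : ι → ι → ℝ} {c' : κ → κ → ℝ} {a b : ι → ℝ} {B ε : ℝ}
    (ha : ∀ i, 0 ≤ a i) (hb : ∀ i, 0 ≤ b i) (hc : ∀ i j, c i j ≤ c' (f i) (f j) + ε)
    (h : HasFinitePlan c' (pushWeight f a) (pushWeight f b) B) :
    HasFinitePlan c a b (B + ε * ∑ i, a i) := by
  obtain ⟨π, h0, h1, h2, h3⟩ := h
  set A := pushWeight f a with hA
  set A' := pushWeight f b with hA'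
  have hπ1 : ∀ k l, A k = 0 → π k l = 0 := fun k l hk =>
    (Finset.sum_eq_zero_iff_of_nonneg (fun l _ => h0 k l)).1 ((h1 k).trans hk) l (Finset.mem_univ _)
  have hπ2 : ∀ k l, A' l = 0 → π k l = 0 := fun k l hl =>
    (Finset.sum_eq_zero_iff_of_nonneg (fun k _ => h0 k l)).1 ((h2 l).trans hl) k (Finset.mem_univ _)
  have hcancel : ∀ {a : ι → ℝ}, (∀ i, 0 ≤ a i) → ∀ i,
      a i / pushWeight f a (f i) * pushWeight f a (f i) = a i := fun {a} ha i => by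
    by_cases h : pushWeight f a (f i) = 0
    · rw [h, mul_zero]; have := le_pushWeight f ha i; linarith [ha i]
    · exact div_mul_cancel₀ _ h
  -- The mass sent from block `k` to block `l` is split proportionally to `a` at the source and to
  -- `b` at the target. Blocks of mass zero, where the quotients are `0`, carry no mass of `π`
  -- either.
  let ρ : ι → ι → ℝ := fun i j => a i / A (f i) * (b j / A' (f j) * π (f i) (f j))
  have hρ0 : ∀ i j, 0 ≤ ρ i j := fun i j =>
    mul_nonneg (div_nonneg (ha i) (pushWeight_nonneg f ha _))
      (mul_nonneg (div_nonneg (hb j) (pushWeight_nonneg f hb _)) (h0 _ _))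
  have hρ1 : ∀ i, ∑ j, ρ i j = a i := fun i => by
    rw [← Finset.mul_sum, sum_split_fibres (w := fun l => π (f i) l) f (hπ2 (f i)), h1]
    exact hcancel ha i
  have hρ2 : ∀ j, ∑ i, ρ i j = b j := fun j => by
    have : ∀ i, ρ i j = b j / A' (f j) * (a i / A (f i) * π (f i) (f j)) := fun i => by
      simp only [ρ]; ring
    rw [Finset.sum_congr rfl fun i _ => this i, ← Finset.mul_sum,
      sum_split_fibres (w := fun k => π k (f j)) f fun k => hπ1 k (f j), h2]
    exact hcancel hb j
  refine ⟨ρ, hρ0, hρ1, hρ2, ?_⟩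
  calc ∑ i, ∑ j, ρ i j * c i j ≤ ∑ i, ∑ j, ρ i j * (c' (f i) (f j) + ε) :=
        Finset.sum_le_sum fun i _ => Finset.sum_le_sum fun j _ =>
          mul_le_mul_of_nonneg_left (hc i j) (hρ0 i j)
    _ = ∑ i, ∑ j, ρ i j * c' (f i) (f j) + ε * ∑ i, a i := by
        simp only [mul_add, Finset.sum_add_distrib, ← Finset.sum_mul, hρ1, mul_comm ε]
    _ = ∑ k, ∑ l, π k l * c' k l + ε * ∑ i, a i := by
        congr 1
        rw [← sum_split_fibres (w := fun k => ∑ l, π k l * c' k l) f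
          fun k hk => Finset.sum_eq_zero fun l _ => by rw [hπ1 k l hk, zero_mul]]
        refine Finset.sum_congr rfl fun i _ => ?_
        rw [← sum_split_fibres (w := fun l => π (f i) l * c' (f i) l) f
          fun l hl => by rw [hπ2 (f i) l hl, zero_mul], Finset.mul_sum]
        exact Finset.sum_congr rfl fun j _ => by simp only [ρ]; ring
    _ ≤ B + ε * ∑ i, a i := by gcongr

/-- The common part of two weights can be left in place. -/
theorem HasFinitePlan.of_sub_inf [DecidableEq ι] {c : ι → ι → ℝ} {a b : ι → ℝ} {B : ℝ}
    (ha : ∀ i, 0 ≤ a i) (hb : ∀ i, 0 ≤ b i) (hc : ∀ i, c i i = 0)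
    (h : HasFinitePlan c (a - a ⊓ b) (b - a ⊓ b) B) : HasFinitePlan c a b B := by
  obtain ⟨π, h0, h1, h2, h3⟩ := h
  refine ⟨fun i j => π i j + if i = j then (a ⊓ b) i else 0, fun i j => ?_, fun i => ?_,
    fun j => ?_, ?_⟩
  · refine add_nonneg (h0 i j) ?_
    split_ifs
    · exact le_min (ha i) (hb i)
    · exact le_rfl
  · rw [Finset.sum_add_distrib, h1]; simp
  · rw [Finset.sum_add_distrib, h2]; simp
  · refine le_of_eq_of_le (Finset.sum_congr rfl fun i _ => Finset.sum_congr rfl fun j _ => ?_) h3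
    beta_reduce
    split_ifs with hij
    · subst hij; simp [hc]
    · simp

/-- The product plan. -/
theorem HasFinitePlan.prod {c : ι → ι → ℝ} {a b : ι → ℝ} {D : ℝ}
    (ha : ∀ i, 0 ≤ a i) (hb : ∀ i, 0 ≤ b i) (hc : ∀ i j, c i j ≤ D)
    (hab : ∑ i, a i = ∑ i, b i) : HasFinitePlan c a b (D * ∑ i, a i) := by
  by_cases hT : ∑ i, b i = 0
  · have hb' : ∀ i, b i = 0 := fun i =>
      (Finset.sum_eq_zero_iff_of_nonneg fun i _ => hb i).1 hT i (Finset.mem_univ _)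
    have ha' : ∀ i, a i = 0 := fun i =>
      (Finset.sum_eq_zero_iff_of_nonneg fun i _ => ha i).1 (hab.trans hT) i (Finset.mem_univ _)
    exact ⟨fun _ _ => 0, by simp, by simp [ha'], by simp [hb'], by simp [ha']⟩
  have hT0 : 0 ≤ ∑ i, b i := Finset.sum_nonneg fun i _ => hb i
  have h1 : ∀ i, ∑ j, a i * b j / ∑ i, b i = a i := fun i => by
    rw [← Finset.sum_div, ← Finset.mul_sum]; field_simp
  have h0 : ∀ i j, 0 ≤ a i * b j / ∑ i, b i := fun i j =>
    div_nonneg (mul_nonneg (ha i) (hb j)) hT0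
  refine ⟨fun i j => a i * b j / ∑ i, b i, h0, h1, fun j => ?_, ?_⟩
  · rw [← Finset.sum_div, ← Finset.sum_mul, hab]; field_simp
  · calc _ ≤ ∑ i, ∑ j, a i * b j / (∑ i, b i) * D :=
        Finset.sum_le_sum fun i _ => Finset.sum_le_sum fun j _ =>
          mul_le_mul_of_nonneg_left (hc i j) (h0 i j)
      _ = D * ∑ i, a i := by simp only [← Finset.sum_mul, h1, mul_comm D]

/-- `a - a ⊓ b` is the positive part of `a - b`, and equal totals make the positive and negative
parts equally heavy. This factor `1/2` cancels the `2` in the costs `2 * R` and `2 * r j`. -/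
theorem sum_sub_inf {a b : ι → ℝ} (hab : ∑ i, a i = ∑ i, b i) :
    ∑ i, (a - a ⊓ b) i = (∑ i, |(a - b) i|) / 2 := by
  have h : ∀ i, (a - a ⊓ b) i = (|(a - b) i| + (a i - b i)) / 2 := fun i => by
    simp only [Pi.sub_apply, Pi.inf_apply]
    rcases le_total (a i) (b i) with h | h
    · rw [inf_eq_left.2 h, abs_of_nonpos (by linarith)]; ring
    · rw [inf_eq_right.2 h, abs_of_nonneg (by linarith)]; ring
  rw [Finset.sum_congr rfl fun i _ => h i, ← Finset.sum_div, Finset.sum_add_distrib,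
    Finset.sum_sub_distrib, hab]
  ring

end FinitePlan

/-! ### The multiscale bound -/

/-- The multiscale bound for transporting along a tree: the total variation of `h` at each
level, weighted by the scale `r` of the next coarser level, and by `R` at the root level. -/
def treeBound (N : ℕ → ℕ) (f : ∀ j, Fin (N (j + 1)) → Fin (N j)) (R : ℝ) (r : ℕ → ℝ) :
    (m : ℕ) → (Fin (N m) → ℝ) → ℝ
  | 0, h => R * ∑ i, |h i|
  | m + 1, h => r m * ∑ i, |h i| + treeBound N f R r m (pushWeight (f m) h)

/-- Induction from the leaves: cancel the common mass, then lift a plan between the parents'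
weights; only the uncancelled mass pays for the step. -/
theorem hasFinitePlan_treeBound {N : ℕ → ℕ} {f : ∀ j, Fin (N (j + 1)) → Fin (N j)} {R : ℝ}
    {r : ℕ → ℝ} {c : ∀ j, Fin (N j) → Fin (N j) → ℝ} (hdiag : ∀ j i, c j i i = 0)
    (htop : ∀ i k, c 0 i k ≤ 2 * R)
    (hstep : ∀ j i k, c (j + 1) i k ≤ c j (f j i) (f j k) + 2 * r j) (m : ℕ)
    {a b : Fin (N m) → ℝ} (ha : ∀ i, 0 ≤ a i) (hb : ∀ i, 0 ≤ b i) (hab : ∑ i, a i = ∑ i, b i) :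
    HasFinitePlan (c m) a b (treeBound N f R r m (a - b)) := by
  induction m with
  | zero =>
    refine HasFinitePlan.of_sub_inf ha hb (hdiag 0) ((HasFinitePlan.prod (D := 2 * R)
      (fun i => ?_) (fun i => ?_) htop ?_).mono ?_)
    · simp
    · simp
    · simp [Finset.sum_sub_distrib, hab]
    · rw [sum_sub_inf hab, treeBound]; apply le_of_eq; ring
  | succ m ih =>
    have ha' : ∀ i, 0 ≤ (a - a ⊓ b) i := fun i => by simp
    have hb' : ∀ i, 0 ≤ (b - a ⊓ b) i := fun i => by simp
    have hab' : ∑ i, (a - a ⊓ b) i = ∑ i, (b - a ⊓ b) i := by simp [Finset.sum_sub_distrib, hab]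
    refine HasFinitePlan.of_sub_inf ha hb (hdiag _) ((HasFinitePlan.lift ha' hb' (hstep m)
      (ih (pushWeight_nonneg _ ha') (pushWeight_nonneg _ hb')
        (by rw [sum_pushWeight, sum_pushWeight, hab']))).mono ?_)
    -- Cancelling the common part does not change the difference, which is all that `treeBound`
    -- sees.
    rw [sum_sub_inf hab, ← pushWeight_sub, sub_sub_sub_cancel_right, treeBound]
    apply le_of_eq; ring

/-! ### Elementary properties of the robust Wasserstein distance -/

theorem isProbabilityMeasure_of_mem_transportPlans {X : Type*} [MeasurableSpace X]
    {μ ν : Measure X} [IsProbabilityMeasure μ]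
    {π : Measure (X × X)} (hπ : π ∈ transportPlans μ ν) : IsProbabilityMeasure π := by
  constructor
  have h : π.map Prod.fst Set.univ = 1 := by rw [hπ.1]; exact measure_univ
  rwa [Measure.map_apply measurable_fst MeasurableSet.univ, Set.preimage_univ] at h

theorem prod_mem_transportPlans {X : Type*} [MeasurableSpace X] (μ ν : Measure X)
    [IsProbabilityMeasure μ] [IsProbabilityMeasure ν] : μ.prod ν ∈ transportPlans μ ν := by
  constructor
  · rw [Measure.map_fst_prod, measure_univ, one_smul]
  · rw [Measure.map_snd_prod, measure_univ, one_smul]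

section Basic

variable {X : Type*} [PseudoMetricSpace X]

theorem trimmedCost_nonneg {lam : ℝ} (hlam : 0 ≤ lam) (x y : X) : 0 ≤ trimmedCost lam x y :=
  le_min dist_nonneg (by positivity)

theorem trimmedCost_self {lam : ℝ} (hlam : 0 ≤ lam) (x : X) : trimmedCost lam x x = 0 := by
  simp [trimmedCost, hlam]

theorem trimmedCost_le_add {lam : ℝ} (x y x' y' : X) :
    trimmedCost lam x y ≤ trimmedCost lam x' y' + (dist x x' + dist y y') := by
  have h := dist_triangle4 x x' y' y
  rw [dist_comm y' y] at h
  have h0 : 0 ≤ dist x x' + dist y y' := by positivity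
  unfold trimmedCost
  rcases le_total (dist x' y') (2 * lam) with h' | h'
  · rw [min_eq_left h']; exact (min_le_left _ _).trans (by linarith)
  · rw [min_eq_right h']; exact (min_le_right _ _).trans (by linarith)

variable [MeasurableSpace X]

theorem robustWasserstein_nonneg {lam : ℝ} (hlam : 0 ≤ lam) (μ ν : Measure X) :
    0 ≤ robustWasserstein lam μ ν := by
  refine Real.sInf_nonneg ?_
  rintro _ ⟨π, -, rfl⟩
  exact integral_nonneg fun z => trimmedCost_nonneg hlam _ _

theorem robustWasserstein_le_integral {lam : ℝ} (hlam : 0 ≤ lam) {μ ν : Measure X}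
    {π : Measure (X × X)} (hπ : π ∈ transportPlans μ ν) :
    robustWasserstein lam μ ν ≤ ∫ z, trimmedCost lam z.1 z.2 ∂π := by
  refine csInf_le ⟨0, ?_⟩ ⟨π, hπ, rfl⟩
  rintro _ ⟨π, -, rfl⟩
  exact integral_nonneg fun z => trimmedCost_nonneg hlam _ _

variable [SecondCountableTopology X] [OpensMeasurableSpace X]

theorem integrable_trimmedCost {lam : ℝ} (hlam : 0 ≤ lam) (π : Measure (X × X))
    [IsFiniteMeasure π] : Integrable (fun z : X × X => trimmedCost lam z.1 z.2) π := by
  refine Integrable.of_bound (C := 2 * lam) ?_ (Filter.Eventually.of_forall fun z => ?_)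
  · exact ((measurable_dist.min measurable_const)).aestronglyMeasurable
  · rw [Real.norm_of_nonneg (trimmedCost_nonneg hlam _ _)]
    exact min_le_right _ _

theorem robustWasserstein_le_of_ae_le {lam D : ℝ} (hlam : 0 ≤ lam) {μ ν : Measure X}
    [IsProbabilityMeasure μ] [IsProbabilityMeasure ν]
    (h : ∀ᵐ z ∂μ.prod ν, trimmedCost lam z.1 z.2 ≤ D) : robustWasserstein lam μ ν ≤ D := by
  refine (robustWasserstein_le_integral hlam (prod_mem_transportPlans μ ν)).trans ?_
  refine (integral_mono_ae (integrable_trimmedCost hlam _) (integrable_const D) h).trans ?_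
  simp

end Basic

/-! ### Lifting a finite plan to a plan between measures -/

section MeasureLift

variable {X : Type*} [MeasurableSpace X] {N : ℕ} {s : X → Fin N}

theorem ae_measure_fibre_ne_zero {μ : Measure X} (hs : Measurable s) :
    ∀ᵐ x ∂μ, μ (s ⁻¹' {s x}) ≠ 0 := by
  have : ∀ᵐ i ∂(μ.map s), μ.map s {i} ≠ 0 := by
    rw [ae_iff]
    have : {i | ¬ μ.map s {i} ≠ 0} = ⋃ i ∈ {i | μ.map s {i} = 0}, {i} := by ext; simp
    rw [this, measure_biUnion_null_iff (Set.to_countable _)]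
    exact fun i hi => hi
  filter_upwards [ae_of_ae_map hs.aemeasurable this] with x hx
  rwa [Measure.map_apply hs (measurableSet_singleton _)] at hx

theorem lintegral_comp_fintype {μ : Measure X} (hs : Measurable s) (g : Fin N → ENNReal) :
    ∫⁻ x, g (s x) ∂μ = ∑ i, g i * μ (s ⁻¹' {i}) := by
  rw [← lintegral_map (measurable_of_finite g) hs, lintegral_fintype]
  refine Finset.sum_congr rfl fun i _ => ?_
  rw [Measure.map_apply hs (measurableSet_singleton _)]

/-- Integrating the lifted density over one variable, with the other in a cell of mass `a`, gives
`1`; this yields both marginals of the lifted plan. -/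
theorem sum_density_mul_eq_one {w : Fin N → ℝ} {a : ℝ} {ν : Measure X} [IsFiniteMeasure ν]
    (hw : ∀ j, 0 ≤ w j) (ha : 0 < a) (hwa : ∑ j, w j = a)
    (hwν : ∀ j, ν.real (s ⁻¹' {j}) = 0 → w j = 0) :
    ∑ j, ENNReal.ofReal (w j / (a * ν.real (s ⁻¹' {j}))) * ν (s ⁻¹' {j}) = 1 := by
  have h : ∀ j, ENNReal.ofReal (w j / (a * ν.real (s ⁻¹' {j}))) * ν (s ⁻¹' {j}) =
      ENNReal.ofReal (w j / a) := fun j => by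
    rw [← ofReal_measureReal (μ := ν), ← ENNReal.ofReal_mul (by have := hw j; positivity)]
    congr 1
    by_cases h0 : ν.real (s ⁻¹' {j}) = 0
    · rw [hwν j h0]; simp
    · field_simp
  rw [Finset.sum_congr rfl fun j _ => h j,
    ← ENNReal.ofReal_sum_of_nonneg fun j _ => div_nonneg (hw j) ha.le, ← Finset.sum_div, hwa,
    div_self ha.ne', ENNReal.ofReal_one]

/-- A plan between the weights that two measures give to the cells of a partition lifts to a
transport plan, giving the same mass to every product of cells. -/
theorem exists_transportPlan_of_finitePlan {μ ν : Measure X} [IsProbabilityMeasure μ]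
    [IsProbabilityMeasure ν] (hs : Measurable s) {w : Fin N → Fin N → ℝ} (hw : ∀ i j, 0 ≤ w i j)
    (h1 : ∀ i, ∑ j, w i j = μ.real (s ⁻¹' {i})) (h2 : ∀ j, ∑ i, w i j = ν.real (s ⁻¹' {j})) :
    ∃ π ∈ transportPlans μ ν, π ≪ μ.prod ν ∧
      ∀ i j, π.real ((s ⁻¹' {i}) ×ˢ (s ⁻¹' {j})) = w i j := by
  have hw1 : ∀ i j, μ.real (s ⁻¹' {i}) = 0 → w i j = 0 := fun i j h =>
    (Finset.sum_eq_zero_iff_of_nonneg (fun j _ => hw i j)).1 ((h1 i).trans h) j (Finset.mem_univ _)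
  have hw2 : ∀ i j, ν.real (s ⁻¹' {j}) = 0 → w i j = 0 := fun i j h =>
    (Finset.sum_eq_zero_iff_of_nonneg (fun i _ => hw i j)).1 ((h2 j).trans h) i (Finset.mem_univ _)
  -- On each product of cells the plan is the product measure, rescaled to have mass `w i j`.
  let g : Fin N → Fin N → ENNReal := fun i j =>
    ENNReal.ofReal (w i j / (μ.real (s ⁻¹' {i}) * ν.real (s ⁻¹' {j})))
  have hg : Measurable fun z : X × X => g (s z.1) (s z.2) :=
    (measurable_of_finite fun p : Fin N × Fin N => g p.1 p.2).comp
      ((hs.comp measurable_fst).prodMk (hs.comp measurable_snd))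
  have hae : ∀ (ρ : Measure X) [IsFiniteMeasure ρ], ∀ᵐ x ∂ρ, 0 < ρ.real (s ⁻¹' {s x}) := fun ρ _ => by
    filter_upwards [ae_measure_fibre_ne_zero (μ := ρ) hs] with x hx
    exact ENNReal.toReal_pos hx (measure_ne_top _ _)
  refine ⟨(μ.prod ν).withDensity fun z => g (s z.1) (s z.2), ⟨?_, ?_⟩,
    withDensity_absolutelyContinuous _ _, fun i j => ?_⟩
  · ext B hB
    rw [Measure.map_apply measurable_fst hB, withDensity_apply _ (measurable_fst hB),
      ← Set.prod_univ, ← Measure.prod_restrict, Measure.restrict_univ,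
      lintegral_prod _ hg.aemeasurable]
    have : ∀ᵐ x ∂μ.restrict B, ∫⁻ y, g (s x) (s y) ∂ν = 1 := by
      refine ae_restrict_of_ae ?_
      filter_upwards [hae μ] with x hx
      rw [lintegral_comp_fintype hs]
      exact sum_density_mul_eq_one (hw _) hx (h1 _) (hw2 _)
    rw [lintegral_congr_ae this]; simp
  · ext B hB
    rw [Measure.map_apply measurable_snd hB, withDensity_apply _ (measurable_snd hB),
      ← Set.univ_prod, ← Measure.prod_restrict, Measure.restrict_univ,
      lintegral_prod_symm _ hg.aemeasurable]
    have : ∀ᵐ y ∂ν.restrict B, ∫⁻ x, g (s x) (s y) ∂μ = 1 := by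
      refine ae_restrict_of_ae ?_
      filter_upwards [hae ν] with y hy
      rw [lintegral_comp_fintype hs fun i => g i (s y)]
      have := sum_density_mul_eq_one (fun i => hw i (s y)) hy (h2 _) fun i => hw1 i (s y)
      simpa only [g, mul_comm (ν.real _)] using this
    rw [lintegral_congr_ae this]; simp
  · have hAi := hs (measurableSet_singleton i)
    have hAj := hs (measurableSet_singleton j)
    have h : ∀ z ∈ (s ⁻¹' {i}) ×ˢ (s ⁻¹' {j}), g (s z.1) (s z.2) = g i j := by
      rintro ⟨x, y⟩ ⟨hx, hy⟩
      have hx : s x = i := hx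
      have hy : s y = j := hy
      simp only [hx, hy]
    rw [measureReal_def, withDensity_apply _ (hAi.prod hAj),
      setLIntegral_congr_fun (hAi.prod hAj) h, setLIntegral_const, Measure.prod_prod,
      ENNReal.toReal_mul, ENNReal.toReal_mul, ← measureReal_def, ← measureReal_def,
      ENNReal.toReal_ofReal (by have := hw i j; positivity)]
    by_cases hi : μ.real (s ⁻¹' {i}) = 0
    · rw [hw1 i j hi]; simp
    by_cases hj : ν.real (s ⁻¹' {j}) = 0
    · rw [hw2 i j hj]; simp
    field_simp

/-- A finite plan between cell weights bounds the robust Wasserstein distance. -/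
theorem robustWasserstein_le_of_hasFinitePlan {X : Type*} [PseudoMetricSpace X]
    [MeasurableSpace X] [SecondCountableTopology X] [OpensMeasurableSpace X] {s : X → Fin N}
    {lam B ε : ℝ} (hlam : 0 ≤ lam) {μ ν : Measure X} [IsProbabilityMeasure μ]
    [IsProbabilityMeasure ν] (hs : Measurable s) {c : Fin N → Fin N → ℝ}
    (hc : ∀ᵐ z ∂μ.prod ν, trimmedCost lam z.1 z.2 ≤ c (s z.1) (s z.2) + ε)
    (h : HasFinitePlan c (fun i => μ.real (s ⁻¹' {i})) (fun i => ν.real (s ⁻¹' {i})) B) :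
    robustWasserstein lam μ ν ≤ B + ε := by
  obtain ⟨w, h0, h1, h2, h3⟩ := h
  -- Absolute continuity carries the cost bound, known only almost everywhere for the product, over
  -- to `π`.
  obtain ⟨π, hπ, hac, hmass⟩ := exists_transportPlan_of_finitePlan hs h0 h1 h2
  have := isProbabilityMeasure_of_mem_transportPlans hπ
  have hss : Measurable fun z : X × X => (s z.1, s z.2) :=
    (hs.comp measurable_fst).prodMk (hs.comp measurable_snd)
  let c' : Fin N × Fin N → ℝ := fun p => c p.1 p.2
  have hint : Integrable c' (π.map fun z : X × X => (s z.1, s z.2)) := Integrable.of_finite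
  have hint' : Integrable (fun z : X × X => c (s z.1) (s z.2)) π := hint.comp_measurable hss
  have hsum : ∫ z, c (s z.1) (s z.2) ∂π = ∑ i, ∑ j, w i j * c i j := by
    have : ∫ z, c (s z.1) (s z.2) ∂π = ∫ p, c' p ∂(π.map fun z : X × X => (s z.1, s z.2)) :=
      (integral_map hss.aemeasurable hint.aestronglyMeasurable).symm
    rw [this, integral_fintype hint, Fintype.sum_prod_type]
    refine Finset.sum_congr rfl fun i _ => Finset.sum_congr rfl fun j _ => ?_
    rw [map_measureReal_apply hss (measurableSet_singleton _), smul_eq_mul, ← hmass i j]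
    congr 2
    ext z; simp
  calc robustWasserstein lam μ ν ≤ ∫ z, trimmedCost lam z.1 z.2 ∂π :=
        robustWasserstein_le_integral hlam hπ
    _ ≤ ∫ z, (c (s z.1) (s z.2) + ε) ∂π :=
        integral_mono_ae (integrable_trimmedCost hlam π) (hint'.add (integrable_const ε))
          (hac.ae_le hc)
    _ = ∑ i, ∑ j, w i j * c i j + ε := by
        rw [integral_add hint' (integrable_const ε), hsum]; simp
    _ ≤ B + ε := by gcongr

end MeasureLift

/-! ### Dependence on the sample points -/

section Empirical

theorem isProbabilityMeasure_empiricalMeasure {X : Type*} [MeasurableSpace X] {n : ℕ}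
    (hn : 0 < n) (x : Fin n → X) : IsProbabilityMeasure (empiricalMeasure x) := by
  constructor
  have : (n : ENNReal) ≠ 0 := by exact_mod_cast hn.ne'
  simp [empiricalMeasure, ENNReal.inv_mul_cancel this (ENNReal.natCast_ne_top n)]

theorem empiricalMeasure_real {X : Type*} [MeasurableSpace X] {n : ℕ} (x : Fin n → X)
    {A : Set X} (hA : MeasurableSet A) :
    (empiricalMeasure x).real A = (n : ℝ)⁻¹ * ∑ i, A.indicator (fun _ => (1 : ℝ)) (x i) := by
  simp only [empiricalMeasure, measureReal_def, Measure.smul_apply, Measure.finsetSum_apply,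
    smul_eq_mul, ENNReal.toReal_mul, ENNReal.toReal_inv, ENNReal.toReal_natCast]
  rw [ENNReal.toReal_sum fun i _ => measure_ne_top _ _]
  congr 1
  refine Finset.sum_congr rfl fun i _ => ?_
  rw [Measure.dirac_apply' _ hA]
  by_cases h : x i ∈ A <;> simp [h]

theorem ae_empiricalMeasure {X : Type*} [MeasurableSpace X] {n : ℕ} {x : Fin n → X}
    {p : X → Prop} (hp : MeasurableSet {y | p y}) (h : ∀ i, p (x i)) :
    ∀ᵐ y ∂empiricalMeasure x, p y := by
  rw [ae_iff]
  have hp' : MeasurableSet {y | ¬ p y} := hp.compl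
  simp [empiricalMeasure, Measure.dirac_apply' _ hp', h]

variable {X : Type*} [MeasurableSpace X] {n : ℕ}

/-- Attaching a measure to each of the points `x i`. -/
theorem exists_eq_sum_prod_dirac [StandardBorelSpace X] [Nonempty X] {μ : Measure X}
    [IsProbabilityMeasure μ] {x : Fin n → X} {π : Measure (X × X)}
    (hπ : π ∈ transportPlans μ (empiricalMeasure x)) :
    ∃ ρ : Fin n → Measure X, (∀ i, IsProbabilityMeasure (ρ i)) ∧
      π = (n : ENNReal)⁻¹ • ∑ i, (ρ i).prod (Measure.dirac (x i)) := by
  have := isProbabilityMeasure_of_mem_transportPlans hπ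
  -- `condKernel` conditions on the first coordinate, and the sample points sit in the second.
  let σ : Measure (X × X) := π.map Prod.swap
  have hσ : IsProbabilityMeasure σ := Measure.isProbabilityMeasure_map measurable_swap.aemeasurable
  have hfst : σ.fst = empiricalMeasure x := by
    rw [← hπ.2, Measure.fst, Measure.map_map measurable_fst measurable_swap]; rfl
  refine ⟨fun i => σ.condKernel (x i), fun i => inferInstance, ?_⟩
  have hσπ : π = σ.map Prod.swap := by
    rw [Measure.map_map measurable_swap measurable_swap, Prod.swap_swap_eq, Measure.map_id]
  ext B hB
  have hB' := measurable_swap hB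
  have hπB : π B = σ (Prod.swap ⁻¹' B) := by
    conv_lhs => rw [hσπ]
    exact Measure.map_apply measurable_swap hB
  rw [hπB]
  conv_lhs => rw [← σ.disintegrate σ.condKernel, Measure.compProd_apply hB', hfst]
  simp only [empiricalMeasure, Measure.smul_apply, Measure.finsetSum_apply, smul_eq_mul,
    lintegral_smul_measure, lintegral_finsetSum_measure]
  congr 1
  refine Finset.sum_congr rfl fun i _ => ?_
  rw [lintegral_dirac' _ (Kernel.measurable_kernel_prodMk_left hB'), Measure.prod_apply_symm hB,
    lintegral_dirac' _ (measurable_measure_prodMk_right hB)]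
  rfl

/-- The first marginal is the average of the `ρ i`, whatever the points they are attached to. -/
theorem sum_prod_dirac_mem_transportPlans {μ : Measure X} {x y : Fin n → X}
    {ρ : Fin n → Measure X} [∀ i, IsProbabilityMeasure (ρ i)]
    (h : (n : ENNReal)⁻¹ • ∑ i, (ρ i).prod (Measure.dirac (x i)) ∈
      transportPlans μ (empiricalMeasure x)) :
    (n : ENNReal)⁻¹ • ∑ i, (ρ i).prod (Measure.dirac (y i)) ∈
      transportPlans μ (empiricalMeasure y) := by
  have hfst : ∀ z : Fin n → X, ((n : ENNReal)⁻¹ • ∑ i, (ρ i).prod (Measure.dirac (z i))).map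
      Prod.fst = (n : ENNReal)⁻¹ • ∑ i, ρ i := fun z => by
    rw [Measure.map_smul, Measure.map_finset_sum measurable_fst.aemeasurable]
    simp
  constructor
  · rw [hfst, ← hfst x]; exact h.1
  · rw [Measure.map_smul, Measure.map_finset_sum measurable_snd.aemeasurable]
    simp [empiricalMeasure]

theorem integral_sum_prod_dirac {ρ : Fin n → Measure X} [∀ i, IsProbabilityMeasure (ρ i)]
    {x : Fin n → X} {f : X × X → ℝ} (hf : Measurable f)
    (hint : ∀ i, Integrable f ((ρ i).prod (Measure.dirac (x i)))) :
    ∫ z, f z ∂((n : ENNReal)⁻¹ • ∑ i, (ρ i).prod (Measure.dirac (x i))) =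
      (n : ℝ)⁻¹ * ∑ i, ∫ z, f (z, x i) ∂(ρ i) := by
  rw [integral_smul_measure, integral_finsetSum_measure fun i _ => hint i]
  simp only [ENNReal.toReal_inv, ENNReal.toReal_natCast, smul_eq_mul]
  congr 1
  refine Finset.sum_congr rfl fun i _ => ?_
  rw [Measure.prod_dirac, integral_map (by fun_prop) hf.aestronglyMeasurable]

/-- The distance to an empirical measure is Lipschitz in the sample points. -/
theorem lipschitzWith_robustWasserstein_empiricalMeasure {X : Type*} [MetricSpace X]
    [MeasurableSpace X] [BorelSpace X] [SecondCountableTopology X] [CompleteSpace X] [Nonempty X]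
    {lam : ℝ} (hlam : 0 ≤ lam) (hn : 0 < n) (μ : Measure X) [IsProbabilityMeasure μ] :
    LipschitzWith 1 fun x : Fin n → X => robustWasserstein lam μ (empiricalMeasure x) := by
  have hmeas : Measurable fun z : X × X => trimmedCost lam z.1 z.2 :=
    measurable_dist.min measurable_const
  -- Take any plan for `x` and drag each `x i`, with its share `ρ i`, to `y i`: the cost grows by at
  -- most the sup distance of `x` and `y`.
  refine LipschitzWith.of_le_add fun y x => ?_
  have := isProbabilityMeasure_empiricalMeasure hn x
  rw [← sub_le_iff_le_add]
  refine le_csInf ⟨_, _, prod_mem_transportPlans μ (empiricalMeasure x), rfl⟩ ?_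
  rintro _ ⟨π, hπ, rfl⟩
  obtain ⟨ρ, hρ, rfl⟩ := exists_eq_sum_prod_dirac hπ
  have hle := robustWasserstein_le_integral hlam (sum_prod_dirac_mem_transportPlans (y := y) hπ)
  beta_reduce
  rw [integral_sum_prod_dirac hmeas fun i => integrable_trimmedCost hlam _] at hle ⊢
  rw [sub_le_iff_le_add]
  refine hle.trans ?_
  have hint : ∀ i (u : X), Integrable (fun z => trimmedCost lam z u) (ρ i) := fun i u => by
    have h := integrable_trimmedCost hlam ((ρ i).prod (Measure.dirac u))
    rw [Measure.prod_dirac] at h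
    exact h.comp_measurable (by fun_prop)
  have hi : ∀ i, ∫ z, trimmedCost lam z (y i) ∂(ρ i) ≤
      ∫ z, trimmedCost lam z (x i) ∂(ρ i) + dist y x := fun i => by
    calc _ ≤ ∫ z, (trimmedCost lam z (x i) + dist y x) ∂(ρ i) := by
          refine integral_mono (hint i _) ((hint i _).add (integrable_const _)) fun z => ?_
          refine (trimmedCost_le_add z (y i) z (x i)).trans ?_
          rw [dist_self, zero_add]
          gcongr
          exact dist_le_pi_dist y x i
      _ = _ := by rw [integral_add (hint i _) (integrable_const _)]; simp
  have hn' : (0 : ℝ) < n := by exact_mod_cast hn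
  calc _ ≤ (n : ℝ)⁻¹ * ∑ i, (∫ z, trimmedCost lam z (x i) ∂(ρ i) + dist y x) := by
        gcongr with i; exact hi i
    _ = _ := by
        rw [Finset.sum_add_distrib, mul_add]; simp [hn'.ne']

/-- An infimum over a possibly uncountable family of plans is not evidently measurable; here
measurability comes from continuity in the sample points, and the bound `2 * lam` gives
integrability. -/
theorem integrable_robustWasserstein_empiricalMeasure {X : Type*} [MetricSpace X]
    [MeasurableSpace X] [BorelSpace X] [SecondCountableTopology X] [CompleteSpace X] [Nonempty X]
    {lam : ℝ} (hlam : 0 ≤ lam) (hn : 0 < n) (μ : Measure X) [IsProbabilityMeasure μ]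
    {Ω : Type*} [MeasurableSpace Ω] (P : Measure Ω) [IsProbabilityMeasure P]
    {Y : Fin n → Ω → X} (hY : ∀ i, AEMeasurable (Y i) P) :
    Integrable (fun ω => robustWasserstein lam μ (empiricalMeasure fun i => Y i ω)) P := by
  refine Integrable.of_bound (C := 2 * lam) ?_ (Filter.Eventually.of_forall fun ω => ?_)
  · exact ((lipschitzWith_robustWasserstein_empiricalMeasure hlam hn μ).continuous.measurable.comp_aemeasurable
      (aemeasurable_pi_lambda (fun ω i => Y i ω) hY)).aestronglyMeasurable
  · have := isProbabilityMeasure_empiricalMeasure hn fun i => Y i ω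
    rw [Real.norm_of_nonneg (robustWasserstein_nonneg hlam _ _)]
    exact robustWasserstein_le_of_ae_le hlam (Filter.Eventually.of_forall fun z => min_le_right _ _)

end Empirical

/-! ### Expected deviation of the empirical measure -/

section Deviation

variable {E : Type*} [MeasurableSpace E] {n : ℕ} {μ : Measure E}
  {Ω : Type*} [MeasurableSpace Ω] {P : Measure Ω} {X : Fin n → Ω → E}

theorem integral_indicator_comp (hX : ∀ i, HasLaw (X i) μ P) {A : Set E} (hA : MeasurableSet A)
    (i : Fin n) : ∫ ω, A.indicator (fun _ => (1 : ℝ)) (X i ω) ∂P = μ.real A := by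
  have hm : Measurable (A.indicator fun _ : E => (1 : ℝ)) := measurable_const.indicator hA
  rw [← integral_map (hX i).aemeasurable hm.aestronglyMeasurable, (hX i).map_eq]
  simp [integral_indicator hA]

variable [IsProbabilityMeasure P]

theorem memLp_indicator_comp (hX : ∀ i, HasLaw (X i) μ P) {A : Set E} (hA : MeasurableSet A)
    (p : ENNReal) (i : Fin n) : MemLp (fun ω => A.indicator (fun _ => (1 : ℝ)) (X i ω)) p P := by
  refine MemLp.of_bound (C := 1) ?_ (Filter.Eventually.of_forall fun ω => ?_)
  · exact ((measurable_const.indicator hA).comp_aemeasurable (hX i).aemeasurable).aestronglyMeasurable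
  · by_cases h : X i ω ∈ A <;> simp [h]

theorem integrable_abs_sub_empiricalMeasure (hX : ∀ i, HasLaw (X i) μ P)
    {A : Set E} (hA : MeasurableSet A) :
    Integrable (fun ω => |μ.real A - (empiricalMeasure fun i => X i ω).real A|) P := by
  simp only [empiricalMeasure_real _ hA]
  refine Integrable.abs ((integrable_const _).sub (Integrable.const_mul ?_ _))
  exact integrable_finsetSum _ fun i _ => (memLp_indicator_comp hX hA 1 i).integrable le_rfl

/-- The empirical mass of `A` is an average of `n` independent Bernoulli variables, so its variance
is at most `μ.real A / n`; the first absolute moment is at most the root of the second. -/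
theorem integral_abs_sub_empiricalMeasure_le (hn : 0 < n) (hX : ∀ i, HasLaw (X i) μ P)
    (hind : iIndepFun X P) {A : Set E} (hA : MeasurableSet A) :
    ∫ ω, |μ.real A - (empiricalMeasure fun i => X i ω).real A| ∂P ≤ √(μ.real A / n) := by
  have hn' : (0 : ℝ) < n := by exact_mod_cast hn
  let Y : Fin n → Ω → ℝ := fun i ω => A.indicator (fun _ => (1 : ℝ)) (X i ω)
  have hY : ∀ i, MemLp (Y i) 2 P := memLp_indicator_comp hX hA 2
  have hYint : ∀ i, ∫ ω, Y i ω ∂P = μ.real A := integral_indicator_comp hX hA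
  have hYind : iIndepFun Y P :=
    hind.comp (fun _ => A.indicator fun _ => (1 : ℝ)) fun _ => measurable_const.indicator hA
  let S : Ω → ℝ := fun ω => (empiricalMeasure fun i => X i ω).real A
  have hS : S = fun ω => (n : ℝ)⁻¹ * (∑ i, Y i) ω := by
    ext ω; simp only [S, empiricalMeasure_real _ hA, Finset.sum_apply, Y]
  have hsumLp : MemLp (∑ i, Y i) 2 P := memLp_finsetSum' _ fun i _ => hY i
  have hSLp : MemLp S 2 P := by rw [hS]; exact hsumLp.const_mul _
  have hSint : ∫ ω, S ω ∂P = μ.real A := by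
    rw [hS, integral_const_mul]
    simp only [Finset.sum_apply]
    rw [integral_finsetSum _ fun i _ => (hY i).integrable (by norm_num)]
    simp [hYint, hn'.ne']
  have hYvar : ∀ i, variance (Y i) P ≤ μ.real A := fun i => by
    refine (variance_le_expectation_sq (hY i).aestronglyMeasurable).trans_eq ?_
    rw [← hYint i]
    refine integral_congr_ae (Filter.Eventually.of_forall fun ω => ?_)
    by_cases h : X i ω ∈ A <;> simp [Y, h]
  have hSvar : variance S P ≤ μ.real A / n := by
    rw [hS, variance_const_mul, IndepFun.variance_sum (fun i _ => hY i)
      fun i _ j _ hij => hYind.indepFun hij]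
    calc _ ≤ (n : ℝ)⁻¹ ^ 2 * ∑ i : Fin n, μ.real A := by gcongr with i; exact hYvar i
      _ = _ := by simp; field_simp
  have hD : MemLp (fun ω => |μ.real A - S ω|) 2 P := ((memLp_const _).sub hSLp).abs
  have h2 : ∫ ω, |μ.real A - S ω| ^ 2 ∂P = variance S P := by
    rw [variance_eq_integral hSLp.aestronglyMeasurable.aemeasurable, hSint]
    refine integral_congr_ae (Filter.Eventually.of_forall fun ω => ?_)
    simp only [sq_abs]; ring
  refine Real.le_sqrt_of_sq_le ?_
  have h3 := variance_nonneg (fun ω => |μ.real A - S ω|) P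
  rw [variance_eq_sub hD] at h3
  have h4 : ∫ ω, |μ.real A - S ω| ^ 2 ∂P ≤ μ.real A / n := h2.trans_le hSvar
  have h5 : 0 ≤ ∫ ω, |μ.real A - S ω| ^ 2 ∂P - (∫ ω, |μ.real A - S ω| ∂P) ^ 2 := h3
  linarith

/-- Cauchy–Schwarz; the bound sees only the number of cells, not the measure. -/
theorem sum_sqrt_le_sqrt_card {N : ℕ} {p : Fin N → ℝ} (hp : ∀ i, 0 ≤ p i) (h1 : ∑ i, p i ≤ 1)
    (n : ℕ) : ∑ i, √(p i / n) ≤ √(N / n) := by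
  refine Real.le_sqrt_of_sq_le ?_
  refine sq_sum_le_card_mul_sum_sq.trans ?_
  have : ∀ i, √(p i / n) ^ 2 = p i / n := fun i => Real.sq_sqrt (by have := hp i; positivity)
  simp only [this, ← Finset.sum_div, Finset.card_univ, Fintype.card_fin]
  rw [mul_div_assoc']
  gcongr
  exact mul_le_of_le_one_right (by positivity) h1

/-- The signed difference of the cell weights of a measure and of an empirical measure. -/
noncomputable def cellDiff {N : ℕ} (μ : Measure E) (s : E → Fin N) (x : Fin n → E) : Fin N → ℝ :=
  (fun i => μ.real (s ⁻¹' {i})) - fun i => (empiricalMeasure x).real (s ⁻¹' {i})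

theorem pushWeight_measureReal (ν : Measure E) [IsFiniteMeasure ν] {N M : ℕ} {s : E → Fin N}
    (hs : Measurable s) (f : Fin N → Fin M) :
    pushWeight f (fun i => ν.real (s ⁻¹' {i})) = fun k => ν.real ((f ∘ s) ⁻¹' {k}) := by
  ext k
  rw [pushWeight, ← measureReal_biUnion_finset]
  · congr 1; ext x; simp
  · intro i _ j _ hij
    exact Disjoint.preimage s (Set.disjoint_singleton.2 hij)
  · exact fun i _ => hs (measurableSet_singleton i)

theorem sum_measureReal_fibre (ν : Measure E) [IsProbabilityMeasure ν] {N : ℕ} {s : E → Fin N}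
    (hs : Measurable s) : ∑ i, ν.real (s ⁻¹' {i}) = 1 := by
  rw [← measureReal_biUnion_finset]
  · have : (⋃ i ∈ (Finset.univ : Finset (Fin N)), s ⁻¹' {i}) = Set.univ := by ext x; simp
    rw [this, probReal_univ]
  · intro i _ j _ hij
    exact Disjoint.preimage s (Set.disjoint_singleton.2 hij)
  · exact fun i _ => hs (measurableSet_singleton i)

theorem integrable_sum_abs_cellDiff (hX : ∀ i, HasLaw (X i) μ P) {N : ℕ} {s : E → Fin N}
    (hs : Measurable s) :
    Integrable (fun ω => ∑ k, |cellDiff μ s (fun i => X i ω) k|) P :=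
  integrable_finsetSum _ fun k _ =>
    integrable_abs_sub_empiricalMeasure hX (hs (measurableSet_singleton k))

variable [IsProbabilityMeasure μ]

theorem integral_sum_abs_cellDiff_le (hn : 0 < n) (hX : ∀ i, HasLaw (X i) μ P)
    (hind : iIndepFun X P) {N : ℕ} {s : E → Fin N} (hs : Measurable s) :
    ∫ ω, ∑ k, |cellDiff μ s (fun i => X i ω) k| ∂P ≤ √(N / n) := by
  have hA := fun k => hs (measurableSet_singleton k)
  refine (integral_finsetSum _ fun k _ =>
    integrable_abs_sub_empiricalMeasure hX (hA k)).trans_le ?_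
  exact (Finset.sum_le_sum fun k _ => integral_abs_sub_empiricalMeasure_le hn hX hind (hA k)).trans
    (sum_sqrt_le_sqrt_card (fun k => measureReal_nonneg) (sum_measureReal_fibre μ hs).le n)

/-- Pushing cell differences to the parents gives the cell differences of the coarser partition `f m
∘ s`, so the `√(N/n)` bound applies at every level. -/
theorem integral_treeBound_le (hn : 0 < n) (hX : ∀ i, HasLaw (X i) μ P) (hind : iIndepFun X P)
    {N : ℕ → ℕ} {f : ∀ j, Fin (N (j + 1)) → Fin (N j)} {R : ℝ} {r : ℕ → ℝ} (hR : 0 ≤ R)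
    (hr : ∀ j, 0 ≤ r j) (m : ℕ) {s : E → Fin (N m)} (hs : Measurable s) :
    Integrable (fun ω => treeBound N f R r m (cellDiff μ s fun i => X i ω)) P ∧
    ∫ ω, treeBound N f R r m (cellDiff μ s fun i => X i ω) ∂P ≤
      R * √(N 0 / n) + ∑ j ∈ Finset.range m, r j * √(N (j + 1) / n) := by
  induction m with
  | zero =>
    simp only [treeBound]
    refine ⟨(integrable_sum_abs_cellDiff hX hs).const_mul R, ?_⟩
    rw [integral_const_mul]
    simpa using mul_le_mul_of_nonneg_left (integral_sum_abs_cellDiff_le hn hX hind hs) hR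
  | succ m ih =>
    have hfs : Measurable (f m ∘ s) := (measurable_of_finite (f m)).comp hs
    have hpush : ∀ ω, pushWeight (f m) (cellDiff μ s fun i => X i ω) =
        cellDiff μ (f m ∘ s) fun i => X i ω := fun ω => by
      have := isProbabilityMeasure_empiricalMeasure hn fun i => X i ω
      rw [cellDiff, pushWeight_sub, pushWeight_measureReal _ hs, pushWeight_measureReal _ hs]
      rfl
    simp only [treeBound, hpush]
    obtain ⟨ih1, ih2⟩ := ih hfs
    have h1 := (integrable_sum_abs_cellDiff hX hs).const_mul (r m)
    refine ⟨h1.add ih1, ?_⟩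
    rw [integral_add h1 ih1, integral_const_mul, Finset.sum_range_succ]
    have := mul_le_mul_of_nonneg_left (integral_sum_abs_cellDiff_le hn hX hind hs) (hr m)
    linarith

end Deviation

/-! ### The multiscale bound for the expected distance -/

section Expectation

variable {d n : ℕ} {K lam : ℝ} {μ : Measure (EuclideanSpace ℝ (Fin d))}
  {Ω : Type*} [MeasurableSpace Ω] {P : Measure Ω}
  {X : Fin n → Ω → EuclideanSpace ℝ (Fin d)}

theorem ae_norm_le (hμ : μ (Metric.closedBall 0 K)ᶜ = 0) : ∀ᵐ x ∂μ, ‖x‖ ≤ K := by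
  rw [ae_iff]
  convert hμ using 2
  ext x; simp

theorem ae_prod_empiricalMeasure_norm_le (hn : 0 < n) (hμ : μ (Metric.closedBall 0 K)ᶜ = 0)
    (hX : ∀ i, HasLaw (X i) μ P) :
    ∀ᵐ ω ∂P, ∀ᵐ z ∂μ.prod (empiricalMeasure fun i => X i ω), ‖z.1‖ ≤ K ∧ ‖z.2‖ ≤ K := by
  have hball : ∀ i, ∀ᵐ ω ∂P, ‖X i ω‖ ≤ K := fun i => by
    have := ae_norm_le hμ
    rw [← (hX i).map_eq] at this
    exact ae_of_ae_map (hX i).aemeasurable this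
  filter_upwards [ae_all_iff.2 hball] with ω hω
  have := isProbabilityMeasure_empiricalMeasure hn fun i => X i ω
  have h1 := Measure.quasiMeasurePreserving_fst (μ := μ)
    (ν := empiricalMeasure fun i => X i ω) |>.ae (ae_norm_le hμ)
  have h2 := Measure.quasiMeasurePreserving_snd (μ := μ)
    (ν := empiricalMeasure fun i => X i ω) |>.ae
      (ae_empiricalMeasure (p := fun y => ‖y‖ ≤ K) (measurableSet_le measurable_norm measurable_const) hω)
  exact h1.and h2

variable [IsProbabilityMeasure μ] [IsProbabilityMeasure P]

theorem integral_robustWasserstein_le_two_mul (hlam : 0 < lam) (hn : 0 < n)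
    (hμ : μ (Metric.closedBall 0 K)ᶜ = 0) (hX : ∀ i, HasLaw (X i) μ P) :
    ∫ ω, robustWasserstein lam μ (empiricalMeasure fun i => X i ω) ∂P ≤ 2 * K := by
  have hint := integrable_robustWasserstein_empiricalMeasure hlam.le hn μ P
    fun i => (hX i).aemeasurable
  have h : ∀ᵐ ω ∂P, robustWasserstein lam μ (empiricalMeasure fun i => X i ω) ≤ 2 * K := by
    filter_upwards [ae_prod_empiricalMeasure_norm_le hn hμ hX] with ω hω
    have := isProbabilityMeasure_empiricalMeasure hn fun i => X i ω
    refine robustWasserstein_le_of_ae_le hlam.le ?_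
    filter_upwards [hω] with z hz
    refine (min_le_left _ _).trans ((dist_le_norm_add_norm _ _).trans ?_)
    linarith [hz.1, hz.2]
  simpa using integral_mono_ae hint (integrable_const (2 * K)) h

/-- The expected robust Wasserstein distance to the empirical measure, bounded by a sum over the
dyadic scales below `R`. -/
theorem integral_robustWasserstein_le_sum (hlam : 0 < lam) (hn : 0 < n)
    (hμ : μ (Metric.closedBall 0 K)ᶜ = 0) (hX : ∀ i, HasLaw (X i) μ P) (hind : iIndepFun X P)
    {R : ℝ} (hR : 0 < R) (hRK : R ≤ K) (hminR : min K lam ≤ R) (m : ℕ) :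
    ∫ ω, robustWasserstein lam μ (empiricalMeasure fun i => X i ω) ∂P ≤
      2 * (R / 2 ^ m) +
        2 * ∑ j ∈ Finset.range (m + 1), R / 2 ^ j * √((3 * K / (R / 2 ^ j)) ^ d / n) := by
  let r : ℕ → ℝ := fun j => R / 2 ^ j
  have hr : ∀ j, 0 < r j := fun j => by positivity
  have hrK : ∀ j, r j ≤ K := fun j => (div_le_self hR.le (one_le_pow₀ one_le_two)).trans hRK
  choose N pos s hN hpos hs hdist using fun j => exists_quantizer d (hr j) (hrK j)
  -- Only `s m` partitions the space; the coarser quantizers act on net points, which makes the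
  -- partitions nested.
  let f : ∀ j, Fin (N (j + 1)) → Fin (N j) := fun j i => s j (pos (j + 1) i)
  let c : ∀ j, Fin (N j) → Fin (N j) → ℝ := fun j i k => trimmedCost lam (pos j i) (pos j k)
  have hdiag : ∀ j i, c j i i = 0 := fun j i => trimmedCost_self hlam.le _
  -- The one place where truncation improves on the plain distance.
  have htop : ∀ i k, c 0 i k ≤ 2 * R := fun i k => by
    refine le_trans ?_ (mul_le_mul_of_nonneg_left hminR zero_le_two)
    rw [mul_min_of_nonneg _ _ zero_le_two]
    refine min_le_min_right _ ((dist_le_norm_add_norm _ _).trans ?_)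
    linarith [hpos 0 i, hpos 0 k]
  have hstep : ∀ j i k, c (j + 1) i k ≤ c j (f j i) (f j k) + 2 * r j := fun j i k => by
    refine (trimmedCost_le_add _ _ (pos j (f j i)) (pos j (f j k))).trans ?_
    have h1 := hdist j _ (hpos (j + 1) i)
    have h2 := hdist j _ (hpos (j + 1) k)
    simp only [c, f]
    linarith
  have hae : ∀ᵐ ω ∂P, robustWasserstein lam μ (empiricalMeasure fun i => X i ω) ≤
      treeBound N f R r m (cellDiff μ (s m) fun i => X i ω) + 2 * r m := by
    filter_upwards [ae_prod_empiricalMeasure_norm_le hn hμ hX] with ω hω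
    have := isProbabilityMeasure_empiricalMeasure hn fun i => X i ω
    refine robustWasserstein_le_of_hasFinitePlan hlam.le (hs m) (c := c m) ?_
      (hasFinitePlan_treeBound hdiag htop hstep m (fun i => measureReal_nonneg)
        (fun i => measureReal_nonneg) ?_)
    · filter_upwards [hω] with z hz
      refine (trimmedCost_le_add _ _ (pos m (s m z.1)) (pos m (s m z.2))).trans ?_
      have h1 := hdist m _ hz.1
      have h2 := hdist m _ hz.2
      simp only [c]
      linarith
    · rw [sum_measureReal_fibre _ (hs m), sum_measureReal_fibre _ (hs m)]
  obtain ⟨htree, hle⟩ := integral_treeBound_le (f := f) hn hX hind hR.le (fun j => (hr j).le) m (hs m)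
  have hint := integrable_robustWasserstein_empiricalMeasure hlam.le hn μ P
    fun i => (hX i).aemeasurable
  have hmain := integral_mono_ae hint (htree.add (integrable_const (2 * r m))) hae
  have hsplit : ∫ ω, ((fun ω => treeBound N f R r m (cellDiff μ (s m) fun i => X i ω)) +
      fun _ : Ω => 2 * r m) ω ∂P =
      ∫ ω, treeBound N f R r m (cellDiff μ (s m) fun i => X i ω) ∂P + 2 * r m := by
    rw [integral_add' htree (integrable_const _)]; simp
  have hterm : ∀ j, √(N j / n) ≤ √((3 * K / r j) ^ d / n) := fun j =>
    Real.sqrt_le_sqrt (div_le_div_of_nonneg_right (hN j) (Nat.cast_nonneg n))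
  have h0 : R * √(N 0 / n) ≤ 2 * (r 0 * √((3 * K / r 0) ^ d / n)) := by
    have h1 := mul_le_mul_of_nonneg_left (hterm 0) hR.le
    have h2 : 0 ≤ R * √((3 * K / r 0) ^ d / n) := by positivity
    have h3 : r 0 = R := by simp [r]
    rw [show r 0 * √((3 * K / r 0) ^ d / n) = R * √((3 * K / r 0) ^ d / n) by rw [h3]]
    linarith
  -- Level `j + 1` is weighted by the coarser scale `r j = 2 * r (j + 1)`, whence the factor `2`;
  -- the root term does not need it.
  have hsucc : ∀ j, r j * √(N (j + 1) / n) ≤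
      2 * (r (j + 1) * √((3 * K / r (j + 1)) ^ d / n)) := fun j => by
    have h2 : r j = 2 * r (j + 1) := by simp only [r, pow_succ]; field_simp
    rw [h2, mul_assoc]
    have := hr (j + 1)
    gcongr
    exact hN (j + 1)
  have hfinal : R * √(N 0 / n) + ∑ j ∈ Finset.range m, r j * √(N (j + 1) / n) ≤
      2 * ∑ j ∈ Finset.range (m + 1), r j * √((3 * K / r j) ^ d / n) := by
    rw [Finset.sum_range_succ', mul_add, Finset.mul_sum, add_comm]
    exact add_le_add (Finset.sum_le_sum fun j _ => hsucc j) h0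
  rw [hsplit] at hmain
  change _ ≤ 2 * r m + 2 * ∑ j ∈ Finset.range (m + 1), r j * √((3 * K / r j) ^ d / n)
  linarith

end Expectation

/-! ### Summing over the scales -/

/-- The ratio is at most `3/4`, and `1 / (1 - 3/4) = 4`. -/
theorem sum_pow_sqrt_half_le (m : ℕ) : ∑ j ∈ Finset.range m, √(1 / 2 : ℝ) ^ j ≤ 4 := by
  have hq0 : 0 ≤ √(1 / 2 : ℝ) := Real.sqrt_nonneg _
  have hq : √(1 / 2 : ℝ) ≤ 3 / 4 := (Real.sqrt_le_left (by norm_num)).2 (by norm_num)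
  have h := geom_sum_mul_neg (√(1 / 2 : ℝ)) m
  have hS : 0 ≤ ∑ j ∈ Finset.range m, √(1 / 2 : ℝ) ^ j := by positivity
  have hp : 0 ≤ √(1 / 2 : ℝ) ^ m := by positivity
  nlinarith [mul_nonneg hS (sub_nonneg.2 hq)]

theorem sqrt_div_two_pow (x : ℝ) (j : ℕ) : √(x / 2 ^ j) = √x * √(1 / 2 : ℝ) ^ j := by
  rw [div_eq_mul_one_div, ← one_div_pow, Real.sqrt_mul' _ (by positivity)]
  congr 1
  rw [Real.sqrt_eq_iff_eq_sq (by positivity) (by positivity), ← pow_mul, mul_comm, pow_mul,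
    Real.sq_sqrt (by norm_num)]

/-- Summing the scales in dimension one. -/
theorem scale_bound_one {K R W : ℝ} {n : ℕ} (hn : 0 < n) (hK : 0 < K) (hR : 0 < R)
    (h : ∀ m : ℕ, W ≤ 2 * (R / 2 ^ m) +
      2 * ∑ j ∈ Finset.range (m + 1), R / 2 ^ j * √((3 * K / (R / 2 ^ j)) ^ 1 / n)) :
    W ≤ 18 * √(K * R / n) := by
  have hn' : (0 : ℝ) < n := by exact_mod_cast hn
  have hS : 0 < √(K * R / n) := by positivity
  obtain ⟨m, hm⟩ := pow_unbounded_of_one_lt (R / √(K * R / n)) (one_lt_two (α := ℝ))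
  have hm' : R / 2 ^ m ≤ √(K * R / n) := by
    rw [div_lt_iff₀ hS] at hm
    rw [div_le_iff₀ (by positivity)]
    linarith
  -- The square of a term is `3KR / (n 2^j)`; `3` is rounded up to `4`. In total `2 + 2 · 2 · 4 =
  -- 18`.
  have hterm : ∀ j : ℕ, R / 2 ^ j * √((3 * K / (R / 2 ^ j)) ^ 1 / n) ≤
      2 * √(K * R / n) * √(1 / 2 : ℝ) ^ j := fun j => by
    have hr : 0 < R / 2 ^ j := by positivity
    calc R / 2 ^ j * √((3 * K / (R / 2 ^ j)) ^ 1 / n)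
        = √((R / 2 ^ j) ^ 2 * ((3 * K / (R / 2 ^ j)) ^ 1 / n)) := by
          rw [Real.sqrt_mul (by positivity), Real.sqrt_sq hr.le]
      _ ≤ √(2 ^ 2 * (K * R / n / 2 ^ j)) := by
          apply Real.sqrt_le_sqrt
          have : (R / 2 ^ j) ^ 2 * ((3 * K / (R / 2 ^ j)) ^ 1 / n) = 3 * (K * R / n / 2 ^ j) := by
            field_simp
          rw [this]
          have : 0 ≤ K * R / n / 2 ^ j := by positivity
          linarith
      _ = _ := by
          rw [Real.sqrt_mul (by positivity), Real.sqrt_sq zero_le_two, sqrt_div_two_pow, mul_assoc]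
  have hsum := Finset.sum_le_sum fun j (_ : j ∈ Finset.range (m + 1)) => hterm j
  rw [← Finset.mul_sum] at hsum
  have := mul_le_mul_of_nonneg_left (sum_pow_sqrt_half_le (m + 1))
    (mul_nonneg zero_le_two hS.le)
  linarith [h m]

/-- Summing the scales in dimension two. -/
theorem scale_bound_two {K R W : ℝ} {n : ℕ} (hn : 0 < n) (hK : 0 < K) (hR : 0 < R)
    (h : ∀ m : ℕ, W ≤ 2 * (R / 2 ^ m) +
      2 * ∑ j ∈ Finset.range (m + 1), R / 2 ^ j * √((3 * K / (R / 2 ^ j)) ^ 2 / n)) :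
    W ≤ 14 * K / √n * (1 + max 0 (Real.log (√n * R / K))) := by
  have hn' : (0 : ℝ) < n := by exact_mod_cast hn
  have hsn : 0 < √(n : ℝ) := Real.sqrt_pos.2 hn'
  set t : ℝ := √n * R / K with ht
  have ht0 : 0 < t := by positivity
  set L : ℝ := max 0 (Real.log t) with hL
  have hlog2 : 1 / 2 ≤ Real.log 2 := by linarith [Real.log_two_gt_d9]
  -- Since `log 2 ≥ 1/2`, this depth gives `2 ^ m ≥ t`, so the finest scale is at most `K / √n`.
  set m : ℕ := ⌈2 * L⌉₊ with hm
  have hLm : 2 * L ≤ m := Nat.le_ceil _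
  have hmL : (m : ℝ) ≤ 2 * L + 1 := (Nat.ceil_lt_add_one (by positivity)).le
  have htm : t ≤ 2 ^ m := by
    rw [← Real.log_le_log_iff ht0 (by positivity), Real.log_pow]
    have h1 : Real.log t ≤ L := le_max_right _ _
    have h2 : (m : ℝ) * (1 / 2) ≤ m * Real.log 2 := by gcongr
    linarith
  have hfine : R / 2 ^ m ≤ K / √n := by
    rw [ht, div_le_iff₀ hK] at htm
    rw [div_le_div_iff₀ (by positivity) hsn]
    linarith
  have hterm : ∀ j : ℕ, R / 2 ^ j * √((3 * K / (R / 2 ^ j)) ^ 2 / n) = 3 * (K / √n) := fun j => by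
    rw [Real.sqrt_div (by positivity), Real.sqrt_sq (by positivity)]
    field_simp
  have hW := h m
  simp only [hterm, Finset.sum_const, Finset.card_range, nsmul_eq_mul] at hW
  push_cast at hW
  have hKn : 0 ≤ K / √n := by positivity
  have hL0 : 0 ≤ L := le_max_left _ _
  rw [mul_div_assoc]
  -- In units of `K / √n` the bound is `2 + 6 (m + 1) ≤ 14 + 12 L`.
  nlinarith [mul_le_mul_of_nonneg_right hmL hKn, mul_nonneg hL0 hKn]

/-- `2K ≤ s` gives `1 ≤ 2 log (s/K)`, and `K R ≤ s` says exactly that `s R / K ≤ (s/K)^2`. -/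
theorem one_add_log_le {K R s : ℝ} (hK : 0 < K) (hR : 0 < R) (hKs : 2 * K ≤ s)
    (hKR : K * R ≤ s) : 1 + max 0 (Real.log (s * R / K)) ≤ 4 * Real.log (s / K) := by
  have hs : 0 < s := by linarith
  have hlog2 : 1 / 2 ≤ Real.log (s / K) := by
    refine le_trans (by linarith [Real.log_two_gt_d9]) (Real.log_le_log zero_lt_two ?_)
    rwa [le_div_iff₀ hK]
  have hlog : Real.log (s * R / K) ≤ 2 * Real.log (s / K) := by
    have : 2 * Real.log (s / K) = Real.log ((s / K) ^ 2) := by rw [Real.log_pow]; norm_cast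
    rw [this]
    refine Real.log_le_log (by positivity) ?_
    rw [div_pow, div_le_div_iff₀ hK (by positivity)]
    nlinarith [mul_le_mul_of_nonneg_left hKR (mul_pos hs hK).le]
  have : max 0 (Real.log (s * R / K)) ≤ 2 * Real.log (s / K) := max_le (by linarith) hlog
  linarith

/-- Summing the scales in dimension at least three. -/
theorem scale_bound_of_three_le {d : ℕ} (hd : 3 ≤ d) {K W : ℝ} {n : ℕ} (hn : 0 < n) (hK : 0 < K)
    (hW : W ≤ 2 * K) (h : ∀ m : ℕ, W ≤ 2 * (K / 2 ^ m) +
      2 * ∑ j ∈ Finset.range (m + 1), K / 2 ^ j * √((3 * K / (K / 2 ^ j)) ^ d / n)) :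
    W ≤ 60 * K / (n : ℝ) ^ (1 / (d : ℝ)) := by
  have hn' : (0 : ℝ) < n := by exact_mod_cast hn
  set a : ℝ := (n : ℝ) ^ (1 / (d : ℝ)) with ha
  have ha0 : 0 < a := by positivity
  have had : a ^ d = n := by
    rw [ha, one_div]; exact Real.rpow_inv_natCast_pow hn'.le (by omega)
  rw [le_div_iff₀ ha0]
  -- For `a < 3` no scale `3 · 2^m ≤ a` is available, and the trivial bound `2K` suffices.
  rcases lt_or_ge a 3 with ha3 | ha3
  · nlinarith [mul_le_mul_of_nonneg_right hW ha0.le]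
  obtain ⟨m, hm1, hm2⟩ := exists_nat_pow_near (x := a / 3) (y := (2 : ℝ))
    (by linarith) one_lt_two
  have hterm : ∀ j ∈ Finset.range (m + 1), K / 2 ^ j * √((3 * K / (K / 2 ^ j)) ^ d / n) ≤
      K / 2 ^ m * √(1 / 2 : ℝ) ^ (m - j) := fun j hj => by
    have hjm : j ≤ m := Nat.lt_succ_iff.1 (Finset.mem_range.1 hj)
    obtain ⟨k, rfl⟩ := Nat.exists_eq_add_of_le hjm
    have hx : 3 * K / (K / 2 ^ j) / a ≤ 1 / 2 ^ k := by
      have : 3 * K / (K / 2 ^ j) = 3 * 2 ^ j := by field_simp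
      rw [this, div_le_div_iff₀ ha0 (by positivity)]
      rw [pow_add] at hm1
      linarith
    -- The choice of `m` makes the base at most `2^(-k) ≤ 1`, so the exponent `d` may be lowered to
    -- `3`. This keeps the constant independent of `d`.
    have hpow : (3 * K / (K / 2 ^ j)) ^ d / n ≤ (1 / 2 ^ k) ^ 2 * (1 / 2 ^ k) := by
      rw [← had, ← div_pow, ← pow_succ]
      refine (pow_le_pow_left₀ (by positivity) hx d).trans ?_
      refine pow_le_pow_of_le_one (by positivity) ?_ hd
      rw [div_le_one (by positivity)]
      exact one_le_pow₀ one_le_two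
    calc K / 2 ^ j * √((3 * K / (K / 2 ^ j)) ^ d / n)
        ≤ K / 2 ^ j * √((1 / 2 ^ k) ^ 2 * (1 / 2 ^ k)) := by gcongr
      _ = K / 2 ^ (j + k) * √(1 / 2 : ℝ) ^ (j + k - j) := by
        rw [Real.sqrt_mul (by positivity), Real.sqrt_sq (by positivity), sqrt_div_two_pow,
          Nat.add_sub_cancel_left, Real.sqrt_one, pow_add]
        field_simp
  have hsum := Finset.sum_le_sum hterm
  rw [← Finset.mul_sum, ← Finset.sum_range_reflect (fun j => √(1 / 2 : ℝ) ^ (m - j))] at hsum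
  have hrefl : ∑ j ∈ Finset.range (m + 1), √(1 / 2 : ℝ) ^ (m - (m + 1 - 1 - j)) =
      ∑ j ∈ Finset.range (m + 1), √(1 / 2 : ℝ) ^ j :=
    Finset.sum_congr rfl fun j hj => by
      have := Finset.mem_range.1 hj
      congr 1; omega
  rw [hrefl] at hsum
  have hKm : 0 < K / 2 ^ m := by positivity
  have hgeo := mul_le_mul_of_nonneg_left (sum_pow_sqrt_half_le (m + 1)) hKm.le
  have hWm : W ≤ 10 * (K / 2 ^ m) := by linarith [h m]
  have ham : a ≤ 6 * 2 ^ m := by rw [pow_succ] at hm2; linarith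
  calc W * a ≤ 10 * (K / 2 ^ m) * a := by gcongr
    _ ≤ 10 * (K / 2 ^ m) * (6 * 2 ^ m) := by gcongr
    _ = 60 * K := by field_simp; norm_num

/-! ### Choice of the root scale and of the constant -/

theorem mainTheorem8 :
    ∃ C : ℝ, 0 < C ∧
      ∀ (d n : ℕ), 0 < n →
      ∀ (K lam : ℝ), 0 < K → 0 < lam →
      ∀ (μ : Measure (EuclideanSpace ℝ (Fin d))) [IsProbabilityMeasure μ],
        μ (Metric.closedBall 0 K)ᶜ = 0 →
      ∀ {Ω : Type*} [MeasurableSpace Ω] (P : Measure Ω) [IsProbabilityMeasure P]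
        (X : Fin n → Ω → EuclideanSpace ℝ (Fin d)),
        (∀ i, HasLaw (X i) μ P) → iIndepFun X P →
        Integrable (fun ω => robustWasserstein lam μ (empiricalMeasure fun i => X i ω)) P ∧
        (d = 1 →
          ∫ ω, robustWasserstein lam μ (empiricalMeasure fun i => X i ω) ∂P
            ≤ C * Real.sqrt (K * min K lam / n)) ∧
        (d = 2 →
          ∫ ω, robustWasserstein lam μ (empiricalMeasure fun i => X i ω) ∂P
            ≤ C * K / Real.sqrt n * (1 + max 0 (Real.log (Real.sqrt n * min K lam / K)))) ∧
        (d = 2 → 2 * K ≤ Real.sqrt n → K * min K lam ≤ Real.sqrt n →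
          ∫ ω, robustWasserstein lam μ (empiricalMeasure fun i => X i ω) ∂P
            ≤ C * K / Real.sqrt n * Real.log (Real.sqrt n / K)) ∧
        (3 ≤ d →
          ∫ ω, robustWasserstein lam μ (empiricalMeasure fun i => X i ω) ∂P
            ≤ C * K / (n : ℝ) ^ (1 / (d : ℝ))) := by
  -- The largest of the constants `18`, `14`, `4 · 14 = 56` and `60` of the separate cases.
  refine ⟨60, by norm_num, ?_⟩
  intro d n hn K lam hK hlam μ _ hμ Ω _ P _ X hX hind
  have hn' : (0 : ℝ) < n := by exact_mod_cast hn
  have hR : 0 < min K lam := lt_min hK hlam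
  have hscale := fun m => integral_robustWasserstein_le_sum hlam hn hμ hX hind hR
    (min_le_left _ _) le_rfl m
  have htwo : d = 2 → ∫ ω, robustWasserstein lam μ (empiricalMeasure fun i => X i ω) ∂P
      ≤ 14 * K / √n * (1 + max 0 (Real.log (√n * min K lam / K))) := by
    rintro rfl
    exact scale_bound_two hn hK hR hscale
  refine ⟨integrable_robustWasserstein_empiricalMeasure hlam.le hn μ P
    fun i => (hX i).aemeasurable, ?_, fun hd => ?_, fun hd hKn hKR => ?_, fun hd => ?_⟩
  · rintro rfl
    refine (scale_bound_one hn hK hR hscale).trans ?_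
    gcongr
    norm_num
  · refine (htwo hd).trans ?_
    gcongr
    norm_num
  · refine (htwo hd).trans ?_
    have h4 := one_add_log_le hK hR hKn hKR
    have hlog : 0 ≤ Real.log (√n / K) := by
      have : 0 ≤ max 0 (Real.log (√n * min K lam / K)) := le_max_left _ _
      linarith
    calc 14 * K / √n * (1 + max 0 (Real.log (√n * min K lam / K)))
        ≤ 14 * K / √n * (4 * Real.log (√n / K)) := by gcongr
      _ = 56 * K / √n * Real.log (√n / K) := by ring
      _ ≤ 60 * K / √n * Real.log (√n / K) := by gcongr; norm_num
  -- Here the coarse scales do not dominate, so the root is taken at `R = K`.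
  · exact scale_bound_of_three_le hd hn hK (integral_robustWasserstein_le_two_mul hlam hn hμ hX)
      fun m => integral_robustWasserstein_le_sum hlam hn hμ hX hind hK le_rfl (min_le_left _ _) m
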